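/- Let $D$ be an oriented link diagram on the sphere $S^2$. Its enhanced checkerboard graph $\Phi(D)$ is the signed directed multigraph whose vertices are all regions of $D$ (of both colours of the checkerboard colouring) and which has, for each crossing, one edge, directed from the region lying between the two incoming strand ends to the opposite region lying between the two outgoing strand ends, and signed by the type of the crossing (its usual sign $\pm1$ as an oriented crossing). The diagram $D$ is called alternative if no walk in $\Phi(D)$ (edges may be traversed in either direction) contains both a positive and a negative edge. Draw a crossing $c$ in a disc with four marked boundary points NE, NW, SW, SE, in any of the four possible positions. Its unoriented sign in this position is $+1$ if the overstrand joins SW and NE, and $-1$ if it joins NW and SE. A rational tangle diagram with continued fraction $[a_1,\dots,a_n]$, $a_i\in\mathbb Z\setminus\{0\}$, is built from a row of $|a_1|$ horizontal twists by adding, for $i=2,\dots,n$, $|a_i|$ twists, vertical ones (above and/or below) if $i$ is even and horizontal ones (left and/or right) if $i$ is odd; the crossings of the $i$-th box have the unoriented sign of $a_i$ in the disc. A block of rational tangles is a tangle obtained from finitely many rational tangles by iterated sums (side by side) and products (one on top of the other). An oriented block of rational tangles extends the oriented crossing $c$ if all denominators $a_i$ of all its rational tangles have the sign of the unoriented crossing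 $c$ in the chosen position, and all its crossings, as oriented crossings, have the same type as $c$. Theorem. Let $D$ be an alternative diagram and let $c$ be any crossing of $D$, in any such position. Let $D^*$ be obtained from $D$ by replacing $c$ by a block of oriented rational tangles that extends $c$ and whose orientation agrees with that of $D$ at the four marked points. Then $D^*$ is again an oriented link diagram on $S^2$, and it is alternative. -/

import Mathlib

/-!
Oriented link diagrams on the sphere, rational tangles and blocks of them, replacement of a
crossing by an oriented tangle, and the enhanced checkerboard graph.

Conventions. The four ends ("darts") of a crossing are numbered counterclockwise by `Fin 4`.
When a crossing, or a tangle, is drawn in a disc with marked boundary points, the numbers are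
`0 = NE`, `1 = NW`, `2 = SW`, `3 = SE`. The corner (local region) between the ends `k` and `k + 1`
is also numbered `k`, so that the corners are `0 = N`, `1 = W`, `2 = S`, `3 = E`.
The sign of an unoriented crossing in such a picture is `+1` if the overstrand joins the
ends `0` and `2`, and `-1` if it joins the ends `1` and `3`; a quarter turn changes it.
-/

namespace Twisting

/-! ### Oriented crossings -/

/-- For an oriented crossing (`out k` says that the end `k` is directed away from the crossing;
opposite ends have opposite directions), the corner between the two outgoing ends. -/
def outCorner (out : Fin 4 → Bool) : Fin 4 :=
  if out 0 then (if out 1 then 0 else 3) else (if out 1 then 1 else 2)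

/-- The type (the usual sign, or writhe) of an oriented crossing, from its unoriented sign in some
numbering of the ends and the directions of the ends: it is `+1` if, looking along the orientation,
the overstrand passes from the lower left to the upper right. It does not depend on the choice
of the numbering. -/
def crossingType (s : ℤˣ) (out : Fin 4 → Bool) : ℤˣ :=
  s * (-1) ^ (outCorner out).val

/-! ### Tangles -/

/-- Tangle diagrams made of single crossings by sums (juxtaposition, left to right) and products
(stacking, top to bottom). -/
inductive Tangle : Type where
  /-- a single crossing with the given (unoriented) sign -/
  | crossing (s : ℤˣ) : Tangle
  /-- `sum A B`: the tangle `A` to the left of the tangle `B` -/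
  | sum (A B : Tangle) : Tangle
  /-- `prod A B`: the tangle `A` on top of the tangle `B` -/
  | prod (A B : Tangle) : Tangle

namespace Tangle

/-- The crossings of a tangle. -/
def Crossing : Tangle → Type
  | crossing _ => Unit
  | sum A B => A.Crossing ⊕ B.Crossing
  | prod A B => A.Crossing ⊕ B.Crossing

instance instFiniteCrossing : (T : Tangle) → Finite T.Crossing
  | crossing _ => inferInstanceAs (Finite Unit)
  | sum A B =>
    haveI := instFiniteCrossing A
    haveI := instFiniteCrossing B
    inferInstanceAs (Finite (A.Crossing ⊕ B.Crossing))
  | prod A B =>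
    haveI := instFiniteCrossing A
    haveI := instFiniteCrossing B
    inferInstanceAs (Finite (A.Crossing ⊕ B.Crossing))

/-- The ends of the crossings of a tangle. -/
abbrev Dart (T : Tangle) : Type := T.Crossing × Fin 4

/-- The unoriented sign of a crossing of a tangle, in the position in which the tangle is drawn. -/
def slope : (T : Tangle) → T.Crossing → ℤˣ
  | crossing s => fun _ => s
  | sum A B => Sum.elim A.slope B.slope
  | prod A B => Sum.elim A.slope B.slope

/-- The crossing at which the strand starting at the marked boundary point `k` arrives first;
it arrives there at the end `k`. -/
def endCrossing : (T : Tangle) → Fin 4 → T.Crossing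
  | crossing _ => fun _ => ()
  | sum A B => fun k => match k with
    | 0 => Sum.inr (B.endCrossing 0)
    | 1 => Sum.inl (A.endCrossing 1)
    | 2 => Sum.inl (A.endCrossing 2)
    | 3 => Sum.inr (B.endCrossing 3)
  | prod A B => fun k => match k with
    | 0 => Sum.inl (A.endCrossing 0)
    | 1 => Sum.inl (A.endCrossing 1)
    | 2 => Sum.inr (B.endCrossing 2)
    | 3 => Sum.inr (B.endCrossing 3)

/-- The dart that is joined to the marked boundary point `k`. -/
def endDart (T : Tangle) (k : Fin 4) : T.Dart := (T.endCrossing k, k)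

/-- The other side of an arc of the tangle diagram: the arc starting at the given dart leads
either to another dart or to a marked boundary point. In a sum, the points `NE`, `SE` of the left
tangle are identified with the points `NW`, `SW` of the right one; in a product, the
points `SW`, `SE` of the upper tangle are identified with the points `NW`, `NE` of the lower one. -/
def partner : (T : Tangle) → T.Dart → T.Dart ⊕ Fin 4
  | crossing _ => fun d => Sum.inr d.2
  | sum A B => fun d => match d with
    | (Sum.inl x, k) => match A.partner (x, k) with
      | Sum.inl e => Sum.inl (Sum.inl e.1, e.2)
      | Sum.inr 0 => Sum.inl (Sum.inr (B.endCrossing 1), 1)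
      | Sum.inr 1 => Sum.inr 1
      | Sum.inr 2 => Sum.inr 2
      | Sum.inr 3 => Sum.inl (Sum.inr (B.endCrossing 2), 2)
    | (Sum.inr x, k) => match B.partner (x, k) with
      | Sum.inl e => Sum.inl (Sum.inr e.1, e.2)
      | Sum.inr 0 => Sum.inr 0
      | Sum.inr 1 => Sum.inl (Sum.inl (A.endCrossing 0), 0)
      | Sum.inr 2 => Sum.inl (Sum.inl (A.endCrossing 3), 3)
      | Sum.inr 3 => Sum.inr 3
  | prod A B => fun d => match d with
    | (Sum.inl x, k) => match A.partner (x, k) with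
      | Sum.inl e => Sum.inl (Sum.inl e.1, e.2)
      | Sum.inr 0 => Sum.inr 0
      | Sum.inr 1 => Sum.inr 1
      | Sum.inr 2 => Sum.inl (Sum.inr (B.endCrossing 1), 1)
      | Sum.inr 3 => Sum.inl (Sum.inr (B.endCrossing 0), 0)
    | (Sum.inr x, k) => match B.partner (x, k) with
      | Sum.inl e => Sum.inl (Sum.inr e.1, e.2)
      | Sum.inr 0 => Sum.inl (Sum.inl (A.endCrossing 3), 3)
      | Sum.inr 1 => Sum.inl (Sum.inl (A.endCrossing 2), 2)
      | Sum.inr 2 => Sum.inr 2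
      | Sum.inr 3 => Sum.inr 3

theorem fin_four (k : Fin 4) : k = 0 ∨ k = 1 ∨ k = 2 ∨ k = 3 := by
  omega

theorem partner_endDart (T : Tangle) (k : Fin 4) : T.partner (T.endDart k) = Sum.inr k := by
  induction T generalizing k with
  | crossing s => rfl
  | sum A B hA hB =>
    simp only [endDart] at hA hB
    rcases fin_four k with rfl | rfl | rfl | rfl <;> simp [endDart, endCrossing, partner, hA, hB]
  | prod A B hA hB =>
    simp only [endDart] at hA hB
    rcases fin_four k with rfl | rfl | rfl | rfl <;> simp [endDart, endCrossing, partner, hA, hB]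

theorem eq_endDart_of_partner (T : Tangle) (d : T.Dart) (k : Fin 4)
    (h : T.partner d = Sum.inr k) : d = T.endDart k := by
  induction T generalizing k with
  | crossing s =>
    obtain ⟨⟨⟩, j⟩ := d
    simp only [partner, Sum.inr.injEq] at h
    subst h
    rfl
  | sum A B hA hB =>
    obtain ⟨x | x, j⟩ := d
    · rcases hp : A.partner (x, j) with e | i
      · simp [partner, hp] at h
      · have hx := hA (x, j) i hp
        simp only [endDart, Prod.mk.injEq] at hx
        obtain ⟨rfl, rfl⟩ := hx
        rcases fin_four j with rfl | rfl | rfl | rfl <;> simp [partner, hp] at h <;> subst h <;> rfl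
    · rcases hp : B.partner (x, j) with e | i
      · simp [partner, hp] at h
      · have hx := hB (x, j) i hp
        simp only [endDart, Prod.mk.injEq] at hx
        obtain ⟨rfl, rfl⟩ := hx
        rcases fin_four j with rfl | rfl | rfl | rfl <;> simp [partner, hp] at h <;> subst h <;> rfl
  | prod A B hA hB =>
    obtain ⟨x | x, j⟩ := d
    · rcases hp : A.partner (x, j) with e | i
      · simp [partner, hp] at h
      · have hx := hA (x, j) i hp
        simp only [endDart, Prod.mk.injEq] at hx
        obtain ⟨rfl, rfl⟩ := hx
        rcases fin_four j with rfl | rfl | rfl | rfl <;> simp [partner, hp] at h <;> subst h <;> rfl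
    · rcases hp : B.partner (x, j) with e | i
      · simp [partner, hp] at h
      · have hx := hB (x, j) i hp
        simp only [endDart, Prod.mk.injEq] at hx
        obtain ⟨rfl, rfl⟩ := hx
        rcases fin_four j with rfl | rfl | rfl | rfl <;> simp [partner, hp] at h <;> subst h <;> rfl

theorem partner_symm (T : Tangle) (d e : T.Dart)
    (h : T.partner d = Sum.inl e) : T.partner e = Sum.inl d := by
  induction T with
  | crossing s => simp [partner] at h
  | sum A B hA hB =>
    have eA := A.partner_endDart
    have eB := B.partner_endDart
    simp only [endDart] at eA eB
    obtain ⟨x | x, j⟩ := d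
    · rcases hp : A.partner (x, j) with f | i
      · have hs := hA (x, j) f hp
        simp only [partner, hp, Sum.inl.injEq] at h
        subst h
        simp [partner, hs]
      · have hx := A.eq_endDart_of_partner (x, j) i hp
        simp only [endDart, Prod.mk.injEq] at hx
        obtain ⟨rfl, rfl⟩ := hx
        rcases fin_four j with rfl | rfl | rfl | rfl <;> simp [partner, hp] at h <;>
          subst h <;> simp [partner, eB]
    · rcases hp : B.partner (x, j) with f | i
      · have hs := hB (x, j) f hp
        simp only [partner, hp, Sum.inl.injEq] at h
        subst h
        simp [partner, hs]
      · have hx := B.eq_endDart_of_partner (x, j) i hp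
        simp only [endDart, Prod.mk.injEq] at hx
        obtain ⟨rfl, rfl⟩ := hx
        rcases fin_four j with rfl | rfl | rfl | rfl <;> simp [partner, hp] at h <;>
          subst h <;> simp [partner, eA]
  | prod A B hA hB =>
    have eA := A.partner_endDart
    have eB := B.partner_endDart
    simp only [endDart] at eA eB
    obtain ⟨x | x, j⟩ := d
    · rcases hp : A.partner (x, j) with f | i
      · have hs := hA (x, j) f hp
        simp only [partner, hp, Sum.inl.injEq] at h
        subst h
        simp [partner, hs]
      · have hx := A.eq_endDart_of_partner (x, j) i hp
        simp only [endDart, Prod.mk.injEq] at hx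
        obtain ⟨rfl, rfl⟩ := hx
        rcases fin_four j with rfl | rfl | rfl | rfl <;> simp [partner, hp] at h <;>
          subst h <;> simp [partner, eB]
    · rcases hp : B.partner (x, j) with f | i
      · have hs := hB (x, j) f hp
        simp only [partner, hp, Sum.inl.injEq] at h
        subst h
        simp [partner, hs]
      · have hx := B.eq_endDart_of_partner (x, j) i hp
        simp only [endDart, Prod.mk.injEq] at hx
        obtain ⟨rfl, rfl⟩ := hx
        rcases fin_four j with rfl | rfl | rfl | rfl <;> simp [partner, hp] at h <;>
          subst h <;> simp [partner, eA]

/-- An orientation of the strands of a tangle diagram: `out d` says that the dart `d` is directed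
away from its crossing. -/
structure Orientation (T : Tangle) where
  out : T.Dart → Bool
  out_opposite : ∀ x k, out (x, k + 2) = !out (x, k)
  out_partner : ∀ d e, T.partner d = Sum.inl e → out e = !out d

/-- The type of a crossing of an oriented tangle. -/
def Orientation.type {T : Tangle} (o : T.Orientation) (x : T.Crossing) : ℤˣ :=
  crossingType (T.slope x) fun k => o.out (x, k)

end Tangle

/-! ### Rational tangles and blocks -/

/-- The sign of a nonzero integer, as a unit. -/
def unitSign (a : ℤ) : ℤˣ := if 0 < a then 1 else -1

/-- A box of twists: a nonzero integer `a`, that is `|a|` crossings with the sign of `a`, of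
which `before` are placed on the left of (resp. above) the tangle already built, and the
others on the right of (resp. below) it. -/
structure Box where
  a : ℤ
  a_ne_zero : a ≠ 0
  before : ℕ
  before_le : before ≤ a.natAbs

/-- Add a row of horizontal twists to a tangle. -/
def Box.addHorizontal (b : Box) (T : Tangle) : Tangle :=
  (fun S => Tangle.sum (.crossing (unitSign b.a)) S)^[b.before]
    ((fun S => Tangle.sum S (.crossing (unitSign b.a)))^[b.a.natAbs - b.before] T)

/-- Add a column of vertical twists to a tangle. -/
def Box.addVertical (b : Box) (T : Tangle) : Tangle :=
  (fun S => Tangle.prod (.crossing (unitSign b.a)) S)^[b.before]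
    ((fun S => Tangle.prod S (.crossing (unitSign b.a)))^[b.a.natAbs - b.before] T)

/-- Add boxes of twists, alternately vertical and horizontal, to a tangle; `vertical` says
whether the first of them is vertical. -/
def addBoxes : (vertical : Bool) → List Box → Tangle → Tangle
  | _, [], T => T
  | true, b :: l, T => addBoxes false l (b.addVertical T)
  | false, b :: l, T => addBoxes true l (b.addHorizontal T)

/-- The diagram of a rational tangle given by a continued fraction `[a₁, a₂, …, aₙ]` with
nonzero denominators, in twist form: start with a row of `|a₁|` horizontal twists and add, for
`i = 2, …, n`, a box of `|aᵢ|` twists, vertical for even `i` and horizontal for odd `i`. -/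
structure RationalTangle where
  a₁ : ℤ
  a₁_ne_zero : a₁ ≠ 0
  boxes : List Box

namespace RationalTangle

/-- The denominators `a₁, a₂, …, aₙ` of the continued fraction. -/
def denominators (R : RationalTangle) : List ℤ := R.a₁ :: R.boxes.map Box.a

/-- The tangle diagram of a rational tangle. -/
def toTangle (R : RationalTangle) : Tangle :=
  addBoxes true R.boxes
    ((fun S => Tangle.sum S (.crossing (unitSign R.a₁)))^[R.a₁.natAbs - 1]
      (.crossing (unitSign R.a₁)))

/-- The rational tangle extends a crossing of (unoriented) sign `ε`: all denominators have the
sign `ε`. -/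
def Extends (R : RationalTangle) (ε : ℤˣ) : Prop :=
  ∀ a ∈ R.denominators, unitSign a = ε

end RationalTangle

/-- A block of rational tangles: a finite iterated sum and product of rational tangles. -/
inductive Block : Type where
  | rational (R : RationalTangle) : Block
  | sum (A B : Block) : Block
  | prod (A B : Block) : Block

namespace Block

/-- The tangle diagram of a block. -/
def toTangle : Block → Tangle
  | rational R => R.toTangle
  | sum A B => .sum A.toTangle B.toTangle
  | prod A B => .prod A.toTangle B.toTangle

/-- The block extends a crossing of (unoriented) sign `ε`: each rational tangle in it does. -/
def Extends (ε : ℤˣ) : Block → Prop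
  | rational R => R.Extends ε
  | sum A B => A.Extends ε ∧ B.Extends ε
  | prod A B => A.Extends ε ∧ B.Extends ε

end Block

/-! ### Oriented link diagrams -/

/-- A combinatorial oriented diagram: finitely many crossings with four ends each, the ends being
joined in pairs by arcs, and finitely many components without crossings (`Loop`).
The condition that it is a diagram on the sphere is `OrientedDiagram.IsSpherical` below.
For a disconnected diagram the data must also tell how the connected pieces lie in each other's
regions: `glue` lists pairs of corners, or sides of loops, that lie in a common region. -/
structure OrientedDiagram where
  Crossing : Type
  Loop : Type
  finite_crossing : Finite Crossing
  finite_loop : Finite Loop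
  /-- the other end of the arc that starts at a dart -/
  join : Crossing × Fin 4 → Crossing × Fin 4
  join_join : ∀ d, join (join d) = d
  /-- the unoriented sign of a crossing with respect to the numbering of its ends -/
  slope : Crossing → ℤˣ
  /-- the dart is directed away from its crossing -/
  out : Crossing × Fin 4 → Bool
  out_opposite : ∀ x k, out (x, k + 2) = !out (x, k)
  out_join : ∀ d, out (join d) = !out d
  /-- pairs of corners or sides of loops (`(l, true)` is the left side and `(l, false)` the right
  side of `l`) that are declared to lie in the same region -/
  glue : (Crossing × Fin 4) ⊕ (Loop × Bool) → (Crossing × Fin 4) ⊕ (Loop × Bool) → Prop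

namespace OrientedDiagram

/-- The ends of the crossings; also the corners, the corner `(x, k)` lying between the ends
`(x, k)` and `(x, k + 1)`. -/
abbrev Dart (D : OrientedDiagram) : Type := D.Crossing × Fin 4

/-- The local pieces of regions: corners at crossings and sides of loops. -/
abbrev Side (D : OrientedDiagram) : Type := D.Dart ⊕ (D.Loop × Bool)

/-- Two local pieces of regions are neighbours: they lie along the same side of an arc (the corner
to the left of a dart, followed to the other end of the arc), or are declared to lie in the same
region. -/
inductive RegionStep (D : OrientedDiagram) : D.Side → D.Side → Prop where
  | arc (d : D.Dart) :
      RegionStep D (Sum.inl d) (Sum.inl ((D.join d).1, (D.join d).2 - 1))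
  | glue (s t : D.Side) (h : D.glue s t) : RegionStep D s t

/-- The regions of a diagram. -/
def Region (D : OrientedDiagram) : Type := Quot D.RegionStep

/-- The region that contains a corner. -/
def regionOf (D : OrientedDiagram) (d : D.Dart) : D.Region := Quot.mk _ (Sum.inl d)

/-- Two darts at the same crossing or on the same arc, or the two sides of a loop, belong to the
same connected piece of the diagram. -/
inductive PieceStep (D : OrientedDiagram) : D.Side → D.Side → Prop where
  | crossing (x : D.Crossing) (k l : Fin 4) : PieceStep D (Sum.inl (x, k)) (Sum.inl (x, l))
  | arc (d : D.Dart) : PieceStep D (Sum.inl d) (Sum.inl (D.join d))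
  | loop (l : D.Loop) (a b : Bool) : PieceStep D (Sum.inr (l, a)) (Sum.inr (l, b))

/-- The connected pieces of the underlying plane curve (not the components of the link). -/
def Piece (D : OrientedDiagram) : Type := Quot D.PieceStep

/-- The diagram lies on the sphere: the surface formed by the regions along the diagram is
connected and Euler's formula `V - E + R = 1 + (number of connected pieces)` holds. Here `E = 2 V`
for the pieces with crossings, and loops contribute nothing to `V - E`. -/
structure IsSpherical (D : OrientedDiagram) : Prop where
  connected : ∀ s t : D.Side,
    Relation.EqvGen (fun a b => D.RegionStep a b ∨ D.PieceStep a b) s t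
  euler : Nat.card D.Region = Nat.card D.Crossing + Nat.card D.Piece + 1

/-- The type (sign as an oriented crossing) of a crossing. -/
def type (D : OrientedDiagram) (x : D.Crossing) : ℤˣ :=
  crossingType (D.slope x) fun k => D.out (x, k)

/-- The unoriented sign of the crossing `x` when it is drawn so that its end number `k` points to
the marked point `k + r` of the disc (`0 = NE`, `1 = NW`, `2 = SW`, `3 = SE`). -/
def signInDisc (D : OrientedDiagram) (x : D.Crossing) (r : Fin 4) : ℤˣ :=
  D.slope x * (-1) ^ r.val

end OrientedDiagram

/-! ### Replacing a crossing by an oriented tangle -/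

/-- The oriented tangle fits into the diagram in place of the crossing `c`, drawn in a disc as
prescribed by `r`: the directions of the strands agree on the boundary of the disc. -/
def Tangle.Orientation.Fits {T : Tangle} (o : T.Orientation) (D : OrientedDiagram)
    (c : D.Crossing) (r : Fin 4) : Prop :=
  ∀ k, o.out (T.endDart (k + r)) = D.out (c, k)

namespace OrientedDiagram

/-- Darts (and corners) of `D` in the diagram in which the crossing `c` is replaced by the
tangle `T`: those at `c` become the darts (corners) of `T` at the boundary of the disc. -/
noncomputable def liftDart (D : OrientedDiagram) (c : D.Crossing) (r : Fin 4) (T : Tangle)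
    (d : D.Dart) : ({x : D.Crossing // x ≠ c} ⊕ T.Crossing) × Fin 4 :=
  open Classical in
  if h : d.1 = c then (Sum.inr (T.endDart (d.2 + r)).1, (T.endDart (d.2 + r)).2)
  else (Sum.inl ⟨d.1, h⟩, d.2)

/-- The other end of an arc after the replacement. -/
noncomputable def replaceJoin (D : OrientedDiagram) (c : D.Crossing) (r : Fin 4) (T : Tangle) :
    ({x : D.Crossing // x ≠ c} ⊕ T.Crossing) × Fin 4 →
      ({x : D.Crossing // x ≠ c} ⊕ T.Crossing) × Fin 4
  | (Sum.inl x, k) => D.liftDart c r T (D.join (x.1, k))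
  | (Sum.inr y, k) => match T.partner (y, k) with
    | Sum.inl e => (Sum.inr e.1, e.2)
    | Sum.inr j => D.liftDart c r T (D.join (c, j - r))

theorem replaceJoin_liftDart (D : OrientedDiagram) (c : D.Crossing) (r : Fin 4) (T : Tangle)
    (d : D.Dart) :
    D.replaceJoin c r T (D.liftDart c r T d) = D.liftDart c r T (D.join d) := by
  obtain ⟨x, k⟩ := d
  by_cases h : x = c
  · subst h
    have h1 := T.partner_endDart (k + r)
    have h2 : D.liftDart x r T (x, k) =
        (Sum.inr (T.endDart (k + r)).1, (T.endDart (k + r)).2) := by simp [liftDart]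
    rw [h2]
    simp only [replaceJoin, h1, add_sub_cancel_right]
  · simp [liftDart, replaceJoin, h]

theorem replaceJoin_replaceJoin (D : OrientedDiagram) (c : D.Crossing) (r : Fin 4) (T : Tangle)
    (d : ({x : D.Crossing // x ≠ c} ⊕ T.Crossing) × Fin 4) :
    D.replaceJoin c r T (D.replaceJoin c r T d) = d := by
  obtain ⟨x | y, k⟩ := d
  · have h1 : D.replaceJoin c r T (Sum.inl x, k) = D.liftDart c r T (D.join (x.1, k)) := rfl
    rw [h1, replaceJoin_liftDart, D.join_join]
    simp [liftDart, x.2]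
  · rcases hp : T.partner (y, k) with e | j
    · have hs := T.partner_symm _ _ hp
      simp [replaceJoin, hp, hs]
    · have hy := T.eq_endDart_of_partner _ _ hp
      have h1 : D.replaceJoin c r T (Sum.inr y, k) = D.liftDart c r T (D.join (c, j - r)) := by
        simp only [replaceJoin, hp]
      rw [h1, replaceJoin_liftDart, D.join_join]
      simp [liftDart, ← hy]

/-- The directions of the darts after the replacement. -/
def replaceOut (D : OrientedDiagram) (c : D.Crossing) {T : Tangle} (o : T.Orientation) :
    ({x : D.Crossing // x ≠ c} ⊕ T.Crossing) × Fin 4 → Bool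
  | (Sum.inl x, k) => D.out (x.1, k)
  | (Sum.inr y, k) => o.out (y, k)

theorem replaceOut_liftDart (D : OrientedDiagram) (c : D.Crossing) (r : Fin 4) {T : Tangle}
    (o : T.Orientation) (h : o.Fits D c r) (d : D.Dart) :
    D.replaceOut c o (D.liftDart c r T d) = D.out d := by
  obtain ⟨x, k⟩ := d
  by_cases hx : x = c
  · subst hx
    simpa [liftDart, replaceOut] using h k
  · simp [liftDart, replaceOut, hx]

theorem replaceOut_replaceJoin (D : OrientedDiagram) (c : D.Crossing) (r : Fin 4) {T : Tangle}
    (o : T.Orientation) (h : o.Fits D c r)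
    (d : ({x : D.Crossing // x ≠ c} ⊕ T.Crossing) × Fin 4) :
    D.replaceOut c o (D.replaceJoin c r T d) = !D.replaceOut c o d := by
  obtain ⟨x | y, k⟩ := d
  · simp only [replaceJoin, D.replaceOut_liftDart c r o h, D.out_join]
    rfl
  · rcases hp : T.partner (y, k) with e | j
    · simpa [replaceJoin, hp, replaceOut] using o.out_partner _ _ hp
    · have hy := T.eq_endDart_of_partner _ _ hp
      simp only [replaceJoin, hp, D.replaceOut_liftDart c r o h, D.out_join]
      have hf := h (j - r)
      rw [sub_add_cancel, ← hy] at hf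
      simp [replaceOut, hf]

/-- The diagram obtained from `D` by replacing the crossing `c`, drawn in a disc as prescribed by
`r`, by the oriented tangle `T`. -/
noncomputable def replace (D : OrientedDiagram) (c : D.Crossing) (r : Fin 4) {T : Tangle}
    (o : T.Orientation) (h : o.Fits D c r) : OrientedDiagram where
  Crossing := {x : D.Crossing // x ≠ c} ⊕ T.Crossing
  Loop := D.Loop
  finite_crossing := haveI := D.finite_crossing; inferInstance
  finite_loop := D.finite_loop
  join := D.replaceJoin c r T
  join_join := D.replaceJoin_replaceJoin c r T
  slope := Sum.elim (fun x => D.slope x.1) T.slope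
  out := D.replaceOut c o
  out_opposite := by
    rintro (x | y) k
    · exact D.out_opposite x.1 k
    · exact o.out_opposite y k
  out_join := D.replaceOut_replaceJoin c r o h
  glue := Relation.Map D.glue (Sum.map (D.liftDart c r T) id) (Sum.map (D.liftDart c r T) id)

end OrientedDiagram

/-- The block, with the orientation `o`, extends the oriented crossing `c` of `D`, drawn in a disc
as prescribed by `r`: the denominators of all its rational tangles have the sign of `c`, and
all its crossings, as oriented crossings, are of the type of `c`. -/
structure Block.ExtendsOriented (B : Block) (o : B.toTangle.Orientation) (D : OrientedDiagram)
    (c : D.Crossing) (r : Fin 4) : Prop where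
  sign : B.Extends (D.signInDisc c r)
  type : ∀ x : B.toTangle.Crossing, o.type x = D.type c

/-! ### The enhanced checkerboard graph -/

/-- A directed multigraph with signed edges. -/
structure SignedDigraph where
  Vertex : Type
  Edge : Type
  source : Edge → Vertex
  target : Edge → Vertex
  sign : Edge → ℤˣ

namespace SignedDigraph

/-- Walks; an edge may be traversed in either direction. -/
inductive Walk (G : SignedDigraph) : G.Vertex → G.Vertex → Type where
  | nil (v : G.Vertex) : Walk G v v
  | forward (e : G.Edge) {v : G.Vertex} (w : Walk G (G.target e) v) : Walk G (G.source e) v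
  | backward (e : G.Edge) {v : G.Vertex} (w : Walk G (G.source e) v) : Walk G (G.target e) v

/-- The edges of a walk. -/
def Walk.edges {G : SignedDigraph} {u v : G.Vertex} : G.Walk u v → List G.Edge
  | .nil _ => []
  | .forward e w => e :: w.edges
  | .backward e w => e :: w.edges

/-- No walk contains both a positive and a negative edge. -/
def IsAlternative (G : SignedDigraph) : Prop :=
  ¬ ∃ (u v : G.Vertex) (w : G.Walk u v),
    (∃ e ∈ w.edges, G.sign e = 1) ∧ ∃ e ∈ w.edges, G.sign e = -1

end SignedDigraph

namespace OrientedDiagram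

/-- The enhanced checkerboard graph: its vertices are all the regions (of both colours). Every
crossing gives an edge, with the type of the crossing as its sign, that runs along the orientation
from the region between the two incoming ends to the region between the two outgoing ends; these
are opposite, hence of the same colour. -/
def enhancedCheckerboardGraph (D : OrientedDiagram) : SignedDigraph where
  Vertex := D.Region
  Edge := D.Crossing
  source x := D.regionOf (x, outCorner (fun k => D.out (x, k)) + 2)
  target x := D.regionOf (x, outCorner fun k => D.out (x, k))
  sign := D.type

/-- A diagram is alternative if its enhanced checkerboard graph is. -/
def IsAlternative (D : OrientedDiagram) : Prop :=
  D.enhancedCheckerboardGraph.IsAlternative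

end OrientedDiagram

end Twisting

/-!
A diagram is alternative if and only if its regions can be labelled by signs so that both ends of
each edge of the enhanced checkerboard graph carry the sign of the edge.

Each sum and each product of tangles encloses exactly one new region, so a tangle with `n`
crossings has `n - 1` inner regions. Replacing a crossing by it therefore adds as many regions as
crossings, and it does not change the connected pieces: Euler's formula persists.

For alternativity, label the inner regions of the tangle by the type of the replaced crossing `c`.
As the crossings of the tangle have both the unoriented sign and the type of `c`, their edges lie
in regions of the same colour as the edge of `c`. Among the regions that meet the boundary of the
disc they can thus only touch the two that the edge of `c` joined, which already carry the type
of `c`.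
-/

namespace Twisting

namespace SignedDigraph

variable {G : SignedDigraph}

theorem isAlternative_iff_forall_sign_eq :
    G.IsAlternative ↔ ∀ (u v : G.Vertex) (w : G.Walk u v),
      ∀ e ∈ w.edges, ∀ e' ∈ w.edges, G.sign e = G.sign e' := by
  refine ⟨fun h u v w e he e' he' => ?_, ?_⟩
  · rcases Int.units_eq_one_or (G.sign e) with hs | hs <;>
      rcases Int.units_eq_one_or (G.sign e') with hs' | hs'
    · rw [hs, hs']
    · exact absurd ⟨u, v, w, ⟨e, he, hs⟩, e', he', hs'⟩ h
    · exact absurd ⟨u, v, w, ⟨e', he', hs'⟩, e, he, hs⟩ h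
    · rw [hs, hs']
  · rintro h ⟨u, v, w, ⟨e, he, hs⟩, e', he', hs'⟩
    have hee' := h u v w e he e' he'
    rw [hs, hs'] at hee'
    exact absurd hee' (by decide)

/-- A labelling of the vertices by signs in which both ends of every edge carry the sign of that
edge. Its existence is a local form of alternativity, without walks. -/
def IsSignLabelling (G : SignedDigraph) (f : G.Vertex → ℤˣ) : Prop :=
  ∀ e, f (G.source e) = G.sign e ∧ f (G.target e) = G.sign e

theorem IsSignLabelling.sign_eq_of_mem_edges {f : G.Vertex → ℤˣ} (hf : G.IsSignLabelling f)
    {u v : G.Vertex} (w : G.Walk u v) {e : G.Edge} (he : e ∈ w.edges) : G.sign e = f u := by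
  induction w with
  | nil u => exact absurd he List.not_mem_nil
  | forward e' w ih =>
    rcases List.mem_cons.1 he with rfl | he
    · exact (hf e).1.symm
    · rw [ih he, (hf e').1, (hf e').2]
  | backward e' w ih =>
    rcases List.mem_cons.1 he with rfl | he
    · exact (hf e).2.symm
    · rw [ih he, (hf e').1, (hf e').2]

open Classical in
theorem isAlternative_iff_exists_isSignLabelling :
    G.IsAlternative ↔ ∃ f, G.IsSignLabelling f := by
  rw [isAlternative_iff_forall_sign_eq]
  constructor
  · intro h
    let startsPositive (u : G.Vertex) : Prop :=
      ∃ (v : G.Vertex) (w : G.Walk u v), ∃ e ∈ w.edges, G.sign e = 1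
    have ite_sign (e : G.Edge) : (if G.sign e = 1 then 1 else -1) = G.sign e := by
      rcases Int.units_eq_one_or (G.sign e) with hs | hs <;> rw [hs] <;> rfl
    have source_iff (e : G.Edge) : startsPositive (G.source e) ↔ G.sign e = 1 := by
      refine ⟨?_, fun hs => ⟨_, .forward e (.nil _), e, List.mem_cons_self, hs⟩⟩
      rintro ⟨v, w, e', he', hs'⟩
      rw [← hs']
      exact h _ v (.backward e w) e List.mem_cons_self e' (List.mem_cons_of_mem e he')
    have target_iff (e : G.Edge) : startsPositive (G.target e) ↔ G.sign e = 1 := by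
      refine ⟨?_, fun hs => ⟨_, .backward e (.nil _), e, List.mem_cons_self, hs⟩⟩
      rintro ⟨v, w, e', he', hs'⟩
      rw [← hs']
      exact h _ v (.forward e w) e List.mem_cons_self e' (List.mem_cons_of_mem e he')
    refine ⟨fun u => if startsPositive u then 1 else -1, fun e => ⟨?_, ?_⟩⟩
    · simp only [source_iff, ite_sign]
    · simp only [target_iff, ite_sign]
  · rintro ⟨f, hf⟩ u v w e he e' he'
    rw [hf.sign_eq_of_mem_edges w he, hf.sign_eq_of_mem_edges w he']

end SignedDigraph

namespace Tangle

variable {A B T : Tangle} {Y : Type*}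

/-- The regions of a tangle diagram that do not meet the boundary of the disc. Every sum and every
product encloses exactly one new such region, `none`, between its two factors. -/
def Inner : Tangle → Type
  | crossing _ => Empty
  | sum A B => Option (A.Inner ⊕ B.Inner)
  | prod A B => Option (A.Inner ⊕ B.Inner)

instance instFiniteInner : (T : Tangle) → Finite T.Inner
  | crossing _ => inferInstanceAs (Finite Empty)
  | sum A B =>
    haveI := instFiniteInner A
    haveI := instFiniteInner B
    inferInstanceAs (Finite (Option (A.Inner ⊕ B.Inner)))
  | prod A B =>
    haveI := instFiniteInner A
    haveI := instFiniteInner B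
    inferInstanceAs (Finite (Option (A.Inner ⊕ B.Inner)))

theorem card_crossing (T : Tangle) : Nat.card T.Crossing = Nat.card T.Inner + 1 := by
  induction T with
  | crossing s =>
    change Nat.card Unit = Nat.card Empty + 1
    rw [Nat.card_unique, Nat.card_of_isEmpty]
  | sum A B hA hB | prod A B hA hB =>
    change Nat.card (A.Crossing ⊕ B.Crossing) = Nat.card (Option (A.Inner ⊕ B.Inner)) + 1
    rw [Nat.card_sum, Finite.card_option, Nat.card_sum, hA, hB]
    omega

theorem partner_endCrossing (T : Tangle) (k : Fin 4) :
    T.partner (T.endCrossing k, k) = Sum.inr k :=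
  T.partner_endDart k

/-- A function on the corners that takes the same value at both ends of each side of every arc,
that is, a function of the regions of the tangle diagram. As for `OrientedDiagram`, the corner on
the left of the dart `(x, k)` is `(x, k)` and the corner on its right is `(x, k - 1)`. -/
def IsRegional (T : Tangle) (q : T.Dart → Y) : Prop :=
  ∀ d e, T.partner d = Sum.inl e → q d = q (e.1, e.2 - 1)

theorem IsRegional.comp {Z : Type*} {q : T.Dart → Y} (hq : T.IsRegional q) (g : Y → Z) :
    T.IsRegional fun d => g (q d) :=
  fun d e hde => congrArg g (hq d e hde)

theorem IsRegional.inl_of_sum {q : (sum A B).Dart → Y} (hq : (sum A B).IsRegional q) :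
    A.IsRegional fun d => q (Sum.inl d.1, d.2) :=
  fun d e hde => hq (Sum.inl d.1, d.2) (Sum.inl e.1, e.2) (by simp only [partner, hde])

theorem IsRegional.inr_of_sum {q : (sum A B).Dart → Y} (hq : (sum A B).IsRegional q) :
    B.IsRegional fun d => q (Sum.inr d.1, d.2) :=
  fun d e hde => hq (Sum.inr d.1, d.2) (Sum.inr e.1, e.2) (by simp only [partner, hde])

theorem IsRegional.inl_of_prod {q : (prod A B).Dart → Y} (hq : (prod A B).IsRegional q) :
    A.IsRegional fun d => q (Sum.inl d.1, d.2) :=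
  fun d e hde => hq (Sum.inl d.1, d.2) (Sum.inl e.1, e.2) (by simp only [partner, hde])

theorem IsRegional.inr_of_prod {q : (prod A B).Dart → Y} (hq : (prod A B).IsRegional q) :
    B.IsRegional fun d => q (Sum.inr d.1, d.2) :=
  fun d e hde => hq (Sum.inr d.1, d.2) (Sum.inr e.1, e.2) (by simp only [partner, hde])

/-- The boundary of the disc between the marked points `k` and `k + 1` lies in one region. -/
theorem IsRegional.apply_endCrossing_add_one {q : T.Dart → Y} (hq : T.IsRegional q) (k : Fin 4) :
    q (T.endCrossing (k + 1), k) = q (T.endCrossing k, k) := by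
  induction T generalizing k with
  | crossing s => rfl
  | sum A B hA hB =>
    have left := hA hq.inl_of_sum
    have right := hB hq.inr_of_sum
    have north := hq (Sum.inl (A.endCrossing 0), 0) (Sum.inr (B.endCrossing 1), 1)
      (by simp only [partner, partner_endCrossing])
    have south := hq (Sum.inr (B.endCrossing 2), 2) (Sum.inl (A.endCrossing 3), 3)
      (by simp only [partner, partner_endCrossing])
    rcases fin_four k with rfl | rfl | rfl | rfl
    · exact (left 0).trans (north.trans (right 0))
    · exact left 1
    · exact (right 2).trans (south.trans (left 2))
    · exact right 3
  | prod A B hA hB =>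
    have upper := hA hq.inl_of_prod
    have lower := hB hq.inr_of_prod
    have west := hq (Sum.inr (B.endCrossing 1), 1) (Sum.inl (A.endCrossing 2), 2)
      (by simp only [partner, partner_endCrossing])
    have east := hq (Sum.inl (A.endCrossing 3), 3) (Sum.inr (B.endCrossing 0), 0)
      (by simp only [partner, partner_endCrossing])
    rcases fin_four k with rfl | rfl | rfl | rfl
    · exact upper 0
    · exact (lower 1).trans (west.trans (upper 1))
    · exact lower 2
    · exact (upper 3).trans (east.trans (lower 3))

theorem isRegional_sum_iff {q : (sum A B).Dart → Y} :
    (sum A B).IsRegional q ↔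
      A.IsRegional (fun d => q (Sum.inl d.1, d.2)) ∧
      B.IsRegional (fun d => q (Sum.inr d.1, d.2)) ∧
      q (Sum.inl (A.endCrossing 0), 0) = q (Sum.inr (B.endCrossing 0), 0) ∧
      q (Sum.inl (A.endCrossing 3), 3) = q (Sum.inr (B.endCrossing 1), 1) ∧
      q (Sum.inl (A.endCrossing 2), 2) = q (Sum.inr (B.endCrossing 2), 2) := by
  refine ⟨fun hq => ?_, fun ⟨hA, hB, north, middle, south⟩ => ?_⟩
  · have left := hq.inl_of_sum.apply_endCrossing_add_one
    have right := hq.inr_of_sum.apply_endCrossing_add_one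
    have north := hq (Sum.inl (A.endCrossing 0), 0) (Sum.inr (B.endCrossing 1), 1)
      (by simp only [partner, partner_endCrossing])
    have middle := hq (Sum.inl (A.endCrossing 3), 3) (Sum.inr (B.endCrossing 2), 2)
      (by simp only [partner, partner_endCrossing])
    have south := hq (Sum.inr (B.endCrossing 2), 2) (Sum.inl (A.endCrossing 3), 3)
      (by simp only [partner, partner_endCrossing])
    exact ⟨hq.inl_of_sum, hq.inr_of_sum, north.trans (right 0), middle.trans (right 1),
      (south.trans (left 2)).symm⟩
  · have left := hA.apply_endCrossing_add_one
    have right := hB.apply_endCrossing_add_one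
    rintro ⟨x | x, k⟩ e hde
    · rcases hp : A.partner (x, k) with e' | j
      · simp only [partner, hp, Sum.inl.injEq] at hde
        subst hde
        exact hA _ _ hp
      · obtain ⟨rfl, rfl⟩ := Prod.mk.inj (A.eq_endDart_of_partner _ _ hp)
        rcases fin_four k with rfl | rfl | rfl | rfl <;>
          simp only [partner, hp, Sum.inl.injEq, reduceCtorEq] at hde <;> subst hde
        · exact north.trans (right 0).symm
        · exact middle.trans (right 1).symm
    · rcases hp : B.partner (x, k) with e' | j
      · simp only [partner, hp, Sum.inl.injEq] at hde
        subst hde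
        exact hB _ _ hp
      · obtain ⟨rfl, rfl⟩ := Prod.mk.inj (B.eq_endDart_of_partner _ _ hp)
        rcases fin_four k with rfl | rfl | rfl | rfl <;>
          simp only [partner, hp, Sum.inl.injEq, reduceCtorEq] at hde <;> subst hde
        · exact middle.symm.trans (left 3).symm
        · exact south.symm.trans (left 2).symm

theorem isRegional_prod_iff {q : (prod A B).Dart → Y} :
    (prod A B).IsRegional q ↔
      A.IsRegional (fun d => q (Sum.inl d.1, d.2)) ∧
      B.IsRegional (fun d => q (Sum.inr d.1, d.2)) ∧
      q (Sum.inl (A.endCrossing 1), 1) = q (Sum.inr (B.endCrossing 1), 1) ∧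
      q (Sum.inl (A.endCrossing 2), 2) = q (Sum.inr (B.endCrossing 0), 0) ∧
      q (Sum.inl (A.endCrossing 3), 3) = q (Sum.inr (B.endCrossing 3), 3) := by
  refine ⟨fun hq => ?_, fun ⟨hA, hB, west, middle, east⟩ => ?_⟩
  · have upper := hq.inl_of_prod.apply_endCrossing_add_one
    have lower := hq.inr_of_prod.apply_endCrossing_add_one
    have west := hq (Sum.inr (B.endCrossing 1), 1) (Sum.inl (A.endCrossing 2), 2)
      (by simp only [partner, partner_endCrossing])
    have middle := hq (Sum.inl (A.endCrossing 2), 2) (Sum.inr (B.endCrossing 1), 1)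
      (by simp only [partner, partner_endCrossing])
    have east := hq (Sum.inl (A.endCrossing 3), 3) (Sum.inr (B.endCrossing 0), 0)
      (by simp only [partner, partner_endCrossing])
    exact ⟨hq.inl_of_prod, hq.inr_of_prod, (west.trans (upper 1)).symm, middle.trans (lower 0),
      east.trans (lower 3)⟩
  · have upper := hA.apply_endCrossing_add_one
    have lower := hB.apply_endCrossing_add_one
    rintro ⟨x | x, k⟩ e hde
    · rcases hp : A.partner (x, k) with e' | j
      · simp only [partner, hp, Sum.inl.injEq] at hde
        subst hde
        exact hA _ _ hp
      · obtain ⟨rfl, rfl⟩ := Prod.mk.inj (A.eq_endDart_of_partner _ _ hp)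
        rcases fin_four k with rfl | rfl | rfl | rfl <;>
          simp only [partner, hp, Sum.inl.injEq, reduceCtorEq] at hde <;> subst hde
        · exact middle.trans (lower 0).symm
        · exact east.trans (lower 3).symm
    · rcases hp : B.partner (x, k) with e' | j
      · simp only [partner, hp, Sum.inl.injEq] at hde
        subst hde
        exact hB _ _ hp
      · obtain ⟨rfl, rfl⟩ := Prod.mk.inj (B.eq_endDart_of_partner _ _ hp)
        rcases fin_four k with rfl | rfl | rfl | rfl <;>
          simp only [partner, hp, Sum.inl.injEq, reduceCtorEq] at hde <;> subst hde
        · exact middle.symm.trans (upper 2).symm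
        · exact west.symm.trans (upper 1).symm

/-- The checkerboard colouring of the regions of a tangle diagram. -/
theorem isRegional_even (T : Tangle) : T.IsRegional fun d => Even d.2.val := by
  induction T with
  | crossing s => exact fun _ _ hde => absurd hde Sum.inr_ne_inl
  | sum A B hA hB => exact isRegional_sum_iff.2 ⟨hA, hB, rfl,
      propext (show Even (3 : Fin 4).val ↔ Even (1 : Fin 4).val by decide), rfl⟩
  | prod A B hA hB => exact isRegional_prod_iff.2 ⟨hA, hB, rfl,
      propext (show Even (2 : Fin 4).val ↔ Even (0 : Fin 4).val by decide), rfl⟩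

/-- Turns the regions of a factor of a sum or product into regions of the whole: the region at
the boundary arc `j₀`, on the side of the other factor, becomes the new inner region `none`. -/
def enclose {I J : Type*} (j₀ : Fin 4) (f : I → J) : Fin 4 ⊕ I → Fin 4 ⊕ Option J
  | Sum.inl j => if j = j₀ then Sum.inr none else Sum.inl j
  | Sum.inr i => Sum.inr (some (f i))

theorem elim_enclose {I J : Type*} {j₀ : Fin 4} {f : I → J} {g g' : Fin 4 → Y} {h : I → Y}
    {h' : Option J → Y} (hg : ∀ j ≠ j₀, g' j = g j) (hnone : h' none = g j₀)
    (hsome : ∀ i, h' (some (f i)) = h i) (s : Fin 4 ⊕ I) :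
    Sum.elim g' h' (enclose j₀ f s) = Sum.elim g h s := by
  rcases s with j | i
  · by_cases hj : j = j₀
    · simp only [enclose, hj, ↓reduceIte, Sum.elim_inr, Sum.elim_inl, hnone]
    · simp only [enclose, hj, ↓reduceIte, Sum.elim_inl, hg j hj]
  · exact hsome i

/-- The region of the tangle diagram that contains a corner: `Sum.inl k` is the one that meets the
boundary of the disc between the marked points `k` and `k + 1`. -/
def region : (T : Tangle) → T.Dart → Fin 4 ⊕ T.Inner
  | crossing _, d => Sum.inl d.2
  | sum A _, (Sum.inl x, k) => enclose 3 Sum.inl (A.region (x, k))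
  | sum _ B, (Sum.inr x, k) => enclose 1 Sum.inr (B.region (x, k))
  | prod A _, (Sum.inl x, k) => enclose 2 Sum.inl (A.region (x, k))
  | prod _ B, (Sum.inr x, k) => enclose 0 Sum.inr (B.region (x, k))

/-- A corner in a given inner region. -/
def innerCorner : (T : Tangle) → T.Inner → T.Dart
  | crossing _, i => i.elim
  | sum A _, none => (Sum.inl (A.endCrossing 3), 3)
  | sum A _, some (Sum.inl i) => (Sum.inl (A.innerCorner i).1, (A.innerCorner i).2)
  | sum _ B, some (Sum.inr i) => (Sum.inr (B.innerCorner i).1, (B.innerCorner i).2)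
  | prod A _, none => (Sum.inl (A.endCrossing 2), 2)
  | prod A _, some (Sum.inl i) => (Sum.inl (A.innerCorner i).1, (A.innerCorner i).2)
  | prod _ B, some (Sum.inr i) => (Sum.inr (B.innerCorner i).1, (B.innerCorner i).2)

theorem region_endCrossing (T : Tangle) (k : Fin 4) :
    T.region (T.endCrossing k, k) = Sum.inl k := by
  induction T generalizing k with
  | crossing s => rfl
  | sum A B hA hB =>
    rcases fin_four k with rfl | rfl | rfl | rfl
    exacts [congrArg (enclose 1 Sum.inr) (hB 0), congrArg (enclose 3 Sum.inl) (hA 1),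
      congrArg (enclose 3 Sum.inl) (hA 2), congrArg (enclose 1 Sum.inr) (hB 3)]
  | prod A B hA hB =>
    rcases fin_four k with rfl | rfl | rfl | rfl
    exacts [congrArg (enclose 2 Sum.inl) (hA 0), congrArg (enclose 2 Sum.inl) (hA 1),
      congrArg (enclose 0 Sum.inr) (hB 2), congrArg (enclose 0 Sum.inr) (hB 3)]

theorem region_innerCorner (T : Tangle) (i : T.Inner) :
    T.region (T.innerCorner i) = Sum.inr i := by
  induction T with
  | crossing s => exact i.elim
  | sum A B hA hB =>
    rcases i with _ | i | i
    exacts [congrArg (enclose 3 Sum.inl) (A.region_endCrossing 3),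
      congrArg (enclose 3 Sum.inl) (hA i), congrArg (enclose 1 Sum.inr) (hB i)]
  | prod A B hA hB =>
    rcases i with _ | i | i
    exacts [congrArg (enclose 2 Sum.inl) (A.region_endCrossing 2),
      congrArg (enclose 2 Sum.inl) (hA i), congrArg (enclose 0 Sum.inr) (hB i)]

theorem isRegional_region (T : Tangle) : T.IsRegional T.region := by
  induction T with
  | crossing s => exact fun _ _ hde => absurd hde Sum.inr_ne_inl
  | sum A B hA hB =>
    have left (k : Fin 4) :=
      congrArg (enclose 3 (Sum.inl (β := B.Inner))) (A.region_endCrossing k)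
    have right (k : Fin 4) :=
      congrArg (enclose 1 (Sum.inr (α := A.Inner))) (B.region_endCrossing k)
    exact isRegional_sum_iff.2 ⟨hA.comp (enclose 3 Sum.inl), hB.comp (enclose 1 Sum.inr),
      (left 0).trans (right 0).symm, (left 3).trans (right 1).symm, (left 2).trans (right 2).symm⟩
  | prod A B hA hB =>
    have upper (k : Fin 4) :=
      congrArg (enclose 2 (Sum.inl (β := B.Inner))) (A.region_endCrossing k)
    have lower (k : Fin 4) :=
      congrArg (enclose 0 (Sum.inr (α := A.Inner))) (B.region_endCrossing k)
    exact isRegional_prod_iff.2 ⟨hA.comp (enclose 2 Sum.inl), hB.comp (enclose 0 Sum.inr),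
      (upper 1).trans (lower 1).symm, (upper 2).trans (lower 0).symm,
      (upper 3).trans (lower 3).symm⟩

theorem region_endCrossing_add_one (T : Tangle) (k : Fin 4) :
    T.region (T.endCrossing (k + 1), k) = Sum.inl k :=
  (T.isRegional_region.apply_endCrossing_add_one k).trans (T.region_endCrossing k)

/-- Regional functions factor through `region`, so that `region` really separates the regions. -/
theorem IsRegional.elim_region {q : T.Dart → Y} (hq : T.IsRegional q) (d : T.Dart) :
    Sum.elim (fun k => q (T.endCrossing k, k)) (fun i => q (T.innerCorner i)) (T.region d) =
      q d := by
  induction T with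
  | crossing s => rfl
  | sum A B hA hB =>
    obtain ⟨hqA, hqB, north, middle, south⟩ := isRegional_sum_iff.1 hq
    obtain ⟨x | x, k⟩ := d
    · refine Eq.trans (elim_enclose (fun j hj => ?_) rfl (fun _ => rfl) _) (hA hqA (x, k))
      rcases fin_four j with rfl | rfl | rfl | rfl
      exacts [north.symm, rfl, rfl, absurd rfl hj]
    · refine Eq.trans (elim_enclose (fun j hj => ?_) middle (fun _ => rfl) _) (hB hqB (x, k))
      rcases fin_four j with rfl | rfl | rfl | rfl
      exacts [rfl, absurd rfl hj, south, rfl]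
  | prod A B hA hB =>
    obtain ⟨hqA, hqB, west, middle, east⟩ := isRegional_prod_iff.1 hq
    obtain ⟨x | x, k⟩ := d
    · refine Eq.trans (elim_enclose (fun j hj => ?_) rfl (fun _ => rfl) _) (hA hqA (x, k))
      rcases fin_four j with rfl | rfl | rfl | rfl
      exacts [rfl, rfl, absurd rfl hj, east.symm]
    · refine Eq.trans (elim_enclose (fun j hj => ?_) middle (fun _ => rfl) _) (hB hqB (x, k))
      rcases fin_four j with rfl | rfl | rfl | rfl
      exacts [absurd rfl hj, west, rfl, rfl]

theorem even_iff_of_region_eq_inl {d : T.Dart} {j : Fin 4} (hd : T.region d = Sum.inl j) :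
    Even j.val ↔ Even d.2.val := by
  have hcolour := T.isRegional_even.elim_region d
  rw [hd] at hcolour
  exact iff_of_eq hcolour

/-- Tangle diagrams are connected. -/
theorem eq_of_eq_on_crossing_of_eq_on_arc {q : T.Dart → Y}
    (hcrossing : ∀ x k l, q (x, k) = q (x, l))
    (harc : ∀ d e, T.partner d = Sum.inl e → q d = q e) (d e : T.Dart) : q d = q e := by
  induction T with
  | crossing s => exact hcrossing () d.2 e.2
  | sum A B hA hB =>
    have left := hA (q := fun d => q (Sum.inl d.1, d.2)) (fun x => hcrossing (Sum.inl x))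
      fun d e hde => harc _ _ (by simp only [partner, hde])
    have right := hB (q := fun d => q (Sum.inr d.1, d.2)) (fun x => hcrossing (Sum.inr x))
      fun d e hde => harc _ _ (by simp only [partner, hde])
    have between := harc (Sum.inl (A.endCrossing 0), 0) (Sum.inr (B.endCrossing 1), 1)
      (by simp only [partner, partner_endCrossing])
    have eq_left : ∀ d, q d = q (Sum.inl (A.endCrossing 0), 0) := by
      rintro ⟨x | x, k⟩
      · exact left (x, k) (A.endCrossing 0, 0)
      · exact (right (x, k) (B.endCrossing 1, 1)).trans between.symm
    rw [eq_left d, eq_left e]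
  | prod A B hA hB =>
    have upper := hA (q := fun d => q (Sum.inl d.1, d.2)) (fun x => hcrossing (Sum.inl x))
      fun d e hde => harc _ _ (by simp only [partner, hde])
    have lower := hB (q := fun d => q (Sum.inr d.1, d.2)) (fun x => hcrossing (Sum.inr x))
      fun d e hde => harc _ _ (by simp only [partner, hde])
    have between := harc (Sum.inl (A.endCrossing 3), 3) (Sum.inr (B.endCrossing 0), 0)
      (by simp only [partner, partner_endCrossing])
    have eq_upper : ∀ d, q d = q (Sum.inl (A.endCrossing 3), 3) := by
      rintro ⟨x | x, k⟩
      · exact upper (x, k) (A.endCrossing 3, 3)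
      · exact (lower (x, k) (B.endCrossing 0, 0)).trans between.symm
    rw [eq_upper d, eq_upper e]

end Tangle

namespace OrientedDiagram

/-- Two local pieces of regions are adjacent on the surface formed by the regions of the diagram.
`IsSpherical` requires any two of them to be linked by a chain of adjacent ones. -/
def Adjacent (D : OrientedDiagram) (s t : D.Side) : Prop := D.RegionStep s t ∨ D.PieceStep s t

end OrientedDiagram

namespace Tangle.Orientation.Fits

variable {D : OrientedDiagram} {c : D.Crossing} {r : Fin 4} {T : Tangle} {o : T.Orientation}
  (h : o.Fits D c r)

/-- `OrientedDiagram.liftDart` as a map into the darts of the new diagram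
`D.replace c r o h`. -/
noncomputable def liftDart : D.Dart → (D.replace c r o h).Dart := D.liftDart c r T

/-- The local piece of a region of the new diagram that corresponds to one of `D`. -/
noncomputable def liftSide : D.Side → (D.replace c r o h).Side := Sum.map h.liftDart id

/-- The darts of the tangle as darts of the new diagram. -/
def tangleDart : T.Dart → (D.replace c r o h).Dart := Prod.map Sum.inr id

theorem liftDart_self (k : Fin 4) : h.liftDart (c, k) = h.tangleDart (T.endDart (k + r)) :=
  dif_pos rfl

theorem liftDart_of_ne {x : D.Crossing} (hx : x ≠ c) (k : Fin 4) :
    h.liftDart (x, k) = (Sum.inl ⟨x, hx⟩, k) :=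
  dif_neg hx

theorem liftDart_sub_self (k : Fin 4) :
    h.liftDart (c, k - r) = h.tangleDart (T.endDart k) := by
  rw [liftDart_self, sub_add_cancel]

theorem join_liftDart (d : D.Dart) :
    (D.replace c r o h).join (h.liftDart d) = h.liftDart (D.join d) :=
  D.replaceJoin_liftDart c r T d

theorem join_tangleDart {d e : T.Dart} (hde : T.partner d = Sum.inl e) :
    (D.replace c r o h).join (h.tangleDart d) = h.tangleDart e := by
  change D.replaceJoin c r T (Sum.inr d.1, d.2) = (Sum.inr e.1, e.2)
  simp only [OrientedDiagram.replaceJoin, hde]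

theorem exists_liftDart_or_partner (d : (D.replace c r o h).Dart) :
    (∃ e, h.liftDart e = d) ∨ ∃ e f, T.partner e = Sum.inl f ∧ h.tangleDart e = d := by
  obtain ⟨x | y, k⟩ := d
  · exact Or.inl ⟨(x.1, k), h.liftDart_of_ne x.2 k⟩
  · rcases hp : T.partner (y, k) with f | j
    · exact Or.inr ⟨(y, k), f, hp, rfl⟩
    · exact Or.inl ⟨(c, j - r), (h.liftDart_sub_self j).trans
        (congrArg h.tangleDart (T.eq_endDart_of_partner _ _ hp).symm)⟩

/-- The region of `D` or inner region of the tangle in which a local piece of a region of the new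
diagram lies. -/
def sideRegion : (D.replace c r o h).Side → D.Region ⊕ T.Inner
  | Sum.inl (Sum.inl x, k) => Sum.inl (D.regionOf (x.1, k))
  | Sum.inl (Sum.inr y, k) => Sum.map (fun j => D.regionOf (c, j - r)) id (T.region (y, k))
  | Sum.inr l => Sum.inl (Quot.mk _ (Sum.inr l))

theorem sideRegion_tangleDart (d : T.Dart) :
    h.sideRegion (Sum.inl (h.tangleDart d)) =
      Sum.map (fun j => D.regionOf (c, j - r)) id (T.region d) :=
  rfl

theorem sideRegion_liftSide (s : D.Side) :
    h.sideRegion (h.liftSide s) = Sum.inl (Quot.mk _ s) := by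
  rcases s with ⟨x, k⟩ | l
  · change h.sideRegion (Sum.inl (h.liftDart (x, k))) = Sum.inl (D.regionOf (x, k))
    by_cases hx : x = c
    · subst hx
      rw [liftDart_self, sideRegion_tangleDart, endDart, region_endCrossing, Sum.map_inl,
        add_sub_cancel_right]
    · rw [h.liftDart_of_ne hx]
      rfl
  · rfl

theorem sideRegion_liftDart_sub_one (d : D.Dart) :
    h.sideRegion (Sum.inl ((h.liftDart d).1, (h.liftDart d).2 - 1)) =
      Sum.inl (D.regionOf (d.1, d.2 - 1)) := by
  obtain ⟨x, k⟩ := d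
  by_cases hx : x = c
  · subst hx
    have hT := T.region_endCrossing_add_one (k + r - 1)
    rw [sub_add_cancel] at hT
    rw [liftDart_self]
    refine (h.sideRegion_tangleDart (T.endCrossing (k + r), k + r - 1)).trans ?_
    rw [hT, Sum.map_inl, add_sub_right_comm, add_sub_cancel_right]
  · rw [h.liftDart_of_ne hx]
    rfl

theorem sideRegion_eq_of_regionStep {s t : (D.replace c r o h).Side}
    (hst : (D.replace c r o h).RegionStep s t) : h.sideRegion s = h.sideRegion t := by
  rcases hst with d | ⟨_, _, s, t, hst, rfl, rfl⟩
  · rcases h.exists_liftDart_or_partner d with ⟨d, rfl⟩ | ⟨d, e, hde, rfl⟩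
    · rw [join_liftDart, sideRegion_liftDart_sub_one]
      exact (h.sideRegion_liftSide (Sum.inl d)).trans
        (congrArg Sum.inl (Quot.sound (.arc d)))
    · rw [h.join_tangleDart hde]
      exact T.isRegional_region.comp (Sum.map (fun j => D.regionOf (c, j - r)) id) d e hde
  · exact (h.sideRegion_liftSide s).trans
      ((congrArg Sum.inl (Quot.sound (.glue s t hst))).trans (h.sideRegion_liftSide t).symm)

theorem isRegional_regionOf_tangleDart :
    T.IsRegional fun d => (D.replace c r o h).regionOf (h.tangleDart d) := by
  intro d e hde
  have harc := OrientedDiagram.RegionStep.arc (D := D.replace c r o h) (h.tangleDart d)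
  rw [h.join_tangleDart hde] at harc
  exact Quot.sound harc

theorem regionOf_liftDart_sub_one (d : D.Dart) :
    (D.replace c r o h).regionOf ((h.liftDart d).1, (h.liftDart d).2 - 1) =
      (D.replace c r o h).regionOf (h.liftDart (d.1, d.2 - 1)) := by
  obtain ⟨x, k⟩ := d
  by_cases hx : x = c
  · subst hx
    have hT := h.isRegional_regionOf_tangleDart.apply_endCrossing_add_one (k + r - 1)
    rw [sub_add_cancel] at hT
    rw [liftDart_self, liftDart_self, sub_add_eq_add_sub]
    exact hT
  · rw [h.liftDart_of_ne hx, h.liftDart_of_ne hx]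
    rfl

/-- The region of the new diagram that corresponds to a region of `D`. -/
noncomputable def liftRegion : D.Region → (D.replace c r o h).Region :=
  Quot.lift (fun s => Quot.mk _ (h.liftSide s)) <| by
    rintro _ _ (d | ⟨_, _, hst⟩)
    · have harc := OrientedDiagram.RegionStep.arc (D := D.replace c r o h) (h.liftDart d)
      rw [join_liftDart] at harc
      exact (Quot.sound harc).trans (h.regionOf_liftDart_sub_one (D.join d))
    · exact Quot.sound (.glue _ _ ⟨_, _, hst, rfl, rfl⟩)

/-- The regions of the new diagram are those of `D` and the inner regions of the tangle. -/
noncomputable def regionEquiv : (D.replace c r o h).Region ≃ D.Region ⊕ T.Inner where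
  toFun := Quot.lift h.sideRegion fun _ _ => h.sideRegion_eq_of_regionStep
  invFun := Sum.elim h.liftRegion fun i =>
    (D.replace c r o h).regionOf (h.tangleDart (T.innerCorner i))
  left_inv := by
    rintro ⟨(⟨x | y, k⟩ | l)⟩
    · exact congrArg (D.replace c r o h).regionOf (h.liftDart_of_ne x.2 k)
    · refine Eq.trans ?_ (h.isRegional_regionOf_tangleDart.elim_region (y, k))
      change Sum.elim _ _ (Sum.map _ _ (T.region (y, k))) = _
      rcases T.region (y, k) with j | i
      · exact congrArg (D.replace c r o h).regionOf (h.liftDart_sub_self j)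
      · rfl
    · rfl
  right_inv := by
    rintro (R | i)
    · obtain ⟨s, rfl⟩ := Quot.exists_rep R
      exact h.sideRegion_liftSide s
    · exact (h.sideRegion_tangleDart _).trans (by rw [T.region_innerCorner, Sum.map_inr, id])

/-- The piece of `D` in which a local piece of a region of the new diagram lies. -/
def sidePiece : (D.replace c r o h).Side → D.Piece
  | Sum.inl (Sum.inl x, k) => Quot.mk _ (Sum.inl (x.1, k))
  | Sum.inl (Sum.inr _, _) => Quot.mk _ (Sum.inl (c, 0))
  | Sum.inr l => Quot.mk _ (Sum.inr l)

theorem sidePiece_liftSide (s : D.Side) : h.sidePiece (h.liftSide s) = Quot.mk _ s := by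
  rcases s with ⟨x, k⟩ | l
  · change h.sidePiece (Sum.inl (h.liftDart (x, k))) = Quot.mk _ (Sum.inl (x, k))
    by_cases hx : x = c
    · subst hx
      rw [liftDart_self]
      exact Quot.sound (.crossing x 0 k)
    · rw [h.liftDart_of_ne hx]
      rfl
  · rfl

theorem sidePiece_eq_of_pieceStep {s t : (D.replace c r o h).Side}
    (hst : (D.replace c r o h).PieceStep s t) : h.sidePiece s = h.sidePiece t := by
  rcases hst with ⟨x | y, k, l⟩ | d | ⟨l, a, b⟩
  · exact Quot.sound (.crossing x.1 k l)
  · rfl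
  · rcases h.exists_liftDart_or_partner d with ⟨d, rfl⟩ | ⟨d, e, hde, rfl⟩
    · rw [join_liftDart]
      exact (h.sidePiece_liftSide (Sum.inl d)).trans
        ((Quot.sound (.arc d)).trans (h.sidePiece_liftSide (Sum.inl (D.join d))).symm)
    · rw [h.join_tangleDart hde]
      rfl
  · exact Quot.sound (OrientedDiagram.PieceStep.loop (D := D) l a b)

theorem piece_tangleDart_eq (d e : T.Dart) :
    (Quot.mk _ (Sum.inl (h.tangleDart d)) : (D.replace c r o h).Piece) =
      Quot.mk _ (Sum.inl (h.tangleDart e)) := by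
  refine eq_of_eq_on_crossing_of_eq_on_arc
    (q := fun d => (Quot.mk _ (Sum.inl (h.tangleDart d)) : (D.replace c r o h).Piece))
    (fun x k l => Quot.sound (.crossing _ k l)) (fun d e hde => ?_) d e
  have harc := OrientedDiagram.PieceStep.arc (D := D.replace c r o h) (h.tangleDart d)
  rw [h.join_tangleDart hde] at harc
  exact Quot.sound harc

/-- The piece of the new diagram that corresponds to a piece of `D`. -/
noncomputable def liftPiece : D.Piece → (D.replace c r o h).Piece :=
  Quot.lift (fun s => Quot.mk _ (h.liftSide s)) <| by
    rintro _ _ (⟨x, k, l⟩ | d | ⟨l, a, b⟩)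
    · change Quot.mk _ (Sum.inl (h.liftDart (x, k))) = Quot.mk _ (Sum.inl (h.liftDart (x, l)))
      by_cases hx : x = c
      · subst hx
        rw [liftDart_self, liftDart_self]
        exact h.piece_tangleDart_eq _ _
      · rw [h.liftDart_of_ne hx, h.liftDart_of_ne hx]
        exact Quot.sound (.crossing _ k l)
    · have harc := OrientedDiagram.PieceStep.arc (D := D.replace c r o h) (h.liftDart d)
      rw [join_liftDart] at harc
      exact Quot.sound harc
    · exact Quot.sound (OrientedDiagram.PieceStep.loop (D := D.replace c r o h) l a b)

/-- The replacement does not change the connected pieces. -/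
noncomputable def pieceEquiv : (D.replace c r o h).Piece ≃ D.Piece where
  toFun := Quot.lift h.sidePiece fun _ _ => h.sidePiece_eq_of_pieceStep
  invFun := h.liftPiece
  left_inv := by
    rintro ⟨(⟨x | y, k⟩ | l)⟩
    · exact congrArg (fun d => Quot.mk _ (Sum.inl d)) (h.liftDart_of_ne x.2 k)
    · exact (congrArg (fun d => Quot.mk _ (Sum.inl d)) (h.liftDart_self 0)).trans
        (h.piece_tangleDart_eq _ (y, k))
    · rfl
  right_inv := by
    rintro ⟨s⟩
    exact h.sidePiece_liftSide s

theorem card_crossing_replace :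
    Nat.card (D.replace c r o h).Crossing = Nat.card D.Crossing + Nat.card T.Inner := by
  classical
  have := D.finite_crossing
  have card_ne : Nat.card {x : D.Crossing // x ≠ c} + 1 = Nat.card D.Crossing := by
    rw [← Finite.card_option]
    exact Nat.card_congr (Equiv.optionSubtypeNe c)
  change Nat.card ({x : D.Crossing // x ≠ c} ⊕ T.Crossing) = _
  rw [Nat.card_sum, T.card_crossing]
  omega

theorem eqvGen_adjacent_liftSide {s t : D.Side} (hst : Relation.EqvGen D.Adjacent s t) :
    Relation.EqvGen (D.replace c r o h).Adjacent (h.liftSide s) (h.liftSide t) := by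
  induction hst with
  | rel s t hst =>
    rcases hst with hst | hst
    · exact (Quot.eqvGen_exact (congrArg h.liftRegion (Quot.sound hst))).mono fun _ _ => Or.inl
    · exact (Quot.eqvGen_exact (congrArg h.liftPiece (Quot.sound hst))).mono fun _ _ => Or.inr
  | refl s => exact .refl _
  | symm s t _ ih => exact .symm _ _ ih
  | trans s t u _ _ hst htu => exact .trans _ _ _ hst htu

theorem exists_eqvGen_adjacent_liftSide (s : (D.replace c r o h).Side) :
    ∃ t, Relation.EqvGen (D.replace c r o h).Adjacent s (h.liftSide t) := by
  obtain ⟨⟨t⟩, ht⟩ := h.pieceEquiv.symm.surjective (Quot.mk _ s)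
  exact ⟨t, (Quot.eqvGen_exact ht.symm).mono fun _ _ => Or.inr⟩

end Tangle.Orientation.Fits

namespace OrientedDiagram

theorem IsSpherical.replace {D : OrientedDiagram} (hD : D.IsSpherical) {c : D.Crossing} {r : Fin 4}
    {T : Tangle} {o : T.Orientation} (h : o.Fits D c r) : (D.replace c r o h).IsSpherical where
  connected s t := by
    obtain ⟨s', hs⟩ := h.exists_eqvGen_adjacent_liftSide s
    obtain ⟨t', ht⟩ := h.exists_eqvGen_adjacent_liftSide t
    exact hs.trans _ _ _ (.trans _ _ _ (h.eqvGen_adjacent_liftSide (hD.connected s' t'))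
      (ht.symm _ _))
  euler := by
    have := D.finite_crossing
    have := D.finite_loop
    have : Finite D.Region := Quot.finite _
    rw [Nat.card_congr h.regionEquiv, Nat.card_sum, hD.euler, Nat.card_congr h.pieceEquiv,
      h.card_crossing_replace]
    omega

end OrientedDiagram

namespace Tangle

variable {ε : ℤˣ} {A B T : Tangle}

/-- All crossings of the tangle diagram have the given unoriented sign. -/
def HasSlope (ε : ℤˣ) (T : Tangle) : Prop := ∀ x, T.slope x = ε

theorem hasSlope_crossing (ε : ℤˣ) : (crossing ε).HasSlope ε := fun _ => rfl

theorem HasSlope.sum (hA : A.HasSlope ε) (hB : B.HasSlope ε) : (sum A B).HasSlope ε :=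
  Sum.rec hA hB

theorem HasSlope.prod (hA : A.HasSlope ε) (hB : B.HasSlope ε) : (prod A B).HasSlope ε :=
  Sum.rec hA hB

theorem HasSlope.addHorizontal (hT : T.HasSlope ε) {b : Box} (hb : unitSign b.a = ε) :
    (b.addHorizontal T).HasSlope ε := by
  subst hb
  exact Function.Iterate.rec (HasSlope _) (Function.Iterate.rec (HasSlope _) hT
    (fun _ h => h.sum (hasSlope_crossing _)) _) (fun _ h => (hasSlope_crossing _).sum h) _

theorem HasSlope.addVertical (hT : T.HasSlope ε) {b : Box} (hb : unitSign b.a = ε) :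
    (b.addVertical T).HasSlope ε := by
  subst hb
  exact Function.Iterate.rec (HasSlope _) (Function.Iterate.rec (HasSlope _) hT
    (fun _ h => h.prod (hasSlope_crossing _)) _) (fun _ h => (hasSlope_crossing _).prod h) _

theorem HasSlope.addBoxes (hT : T.HasSlope ε) {l : List Box} (hl : ∀ b ∈ l, unitSign b.a = ε)
    (vertical : Bool) : (addBoxes vertical l T).HasSlope ε := by
  induction l generalizing vertical T with
  | nil => cases vertical <;> exact hT
  | cons b l ih =>
    obtain ⟨hb, hl⟩ := List.forall_mem_cons.1 hl
    cases vertical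
    · exact ih (hT.addHorizontal hb) hl true
    · exact ih (hT.addVertical hb) hl false

end Tangle

theorem RationalTangle.Extends.hasSlope {ε : ℤˣ} {R : RationalTangle} (hR : R.Extends ε) :
    R.toTangle.HasSlope ε := by
  obtain ⟨ha₁, hboxes⟩ := List.forall_mem_cons.1 hR
  refine Tangle.HasSlope.addBoxes ?_ (fun b hb => hboxes _ (List.mem_map_of_mem hb)) true
  rw [ha₁]
  exact Function.Iterate.rec (Tangle.HasSlope ε) (Tangle.hasSlope_crossing ε)
    (fun _ h => h.sum (Tangle.hasSlope_crossing ε)) _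

theorem Block.Extends.hasSlope {ε : ℤˣ} {B : Block} (hB : B.Extends ε) :
    B.toTangle.HasSlope ε := by
  induction B with
  | rational R => exact RationalTangle.Extends.hasSlope hB
  | sum A B hA hB' => exact (hA hB.1).sum (hB' hB.2)
  | prod A B hA hB' => exact (hA hB.1).prod (hB' hB.2)

theorem neg_one_pow_val_mul_eq_iff (i j r : Fin 4) :
    (-1 : ℤˣ) ^ r.val * (-1) ^ i.val = (-1) ^ j.val ↔ (Even (i - r).val ↔ Even j.val) := by
  revert i j r
  decide

theorem crossingType_mul_eq_iff {s : ℤˣ} {r : Fin 4} {out out' : Fin 4 → Bool} :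
    crossingType (s * (-1) ^ r.val) out = crossingType s out' ↔
      (Even (outCorner out - r).val ↔ Even (outCorner out').val) := by
  rw [crossingType, crossingType, mul_assoc, mul_right_inj, neg_one_pow_val_mul_eq_iff]

theorem even_val_sub_congr {i j : Fin 4} (r : Fin 4) (hij : Even i.val ↔ Even j.val) :
    Even (i - r).val ↔ Even (j - r).val := by
  revert i j r
  decide

theorem even_val_add_two (i : Fin 4) : Even (i + 2).val ↔ Even i.val := by
  revert i
  decide

theorem eq_or_eq_add_two_of_even_iff {i j : Fin 4} (hij : Even i.val ↔ Even j.val) :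
    i = j ∨ i = j + 2 := by
  revert i j
  decide

namespace OrientedDiagram

variable {D : OrientedDiagram} {c : D.Crossing} {r : Fin 4} {T : Tangle} {o : T.Orientation}

theorem apply_regionOf_eq_type {f : D.Region → ℤˣ}
    (hf : D.enhancedCheckerboardGraph.IsSignLabelling f) {k : Fin 4}
    (hk : Even k.val ↔ Even (outCorner fun k => D.out (c, k)).val) :
    f (D.regionOf (c, k)) = D.type c := by
  rcases eq_or_eq_add_two_of_even_iff hk with rfl | rfl
  · exact (hf c).2
  · exact (hf c).1

theorem elim_sideRegion_tangleDart_eq_type (h : o.Fits D c r) {f : D.Region → ℤˣ}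
    (hf : D.enhancedCheckerboardGraph.IsSignLabelling f) (hs : T.HasSlope (D.signInDisc c r))
    {y : T.Crossing} (hy : o.type y = D.type c) {k : Fin 4}
    (hk : Even k.val ↔ Even (outCorner fun k => o.out (y, k)).val) :
    Sum.elim f (fun _ => D.type c) (h.sideRegion (Sum.inl (h.tangleDart (y, k)))) = o.type y := by
  rw [h.sideRegion_tangleDart, hy]
  rcases hp : T.region (y, k) with j | i
  · rw [Tangle.Orientation.type, hs y] at hy
    have hj := (Tangle.even_iff_of_region_eq_inl hp).trans hk
    exact apply_regionOf_eq_type hf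
      ((even_val_sub_congr r hj).trans (crossingType_mul_eq_iff.1 hy))
  · rfl

theorem IsAlternative.replace (hD : D.IsAlternative) (h : o.Fits D c r)
    (hs : T.HasSlope (D.signInDisc c r)) (ht : ∀ y, o.type y = D.type c) :
    IsAlternative (D.replace c r o h) := by
  obtain ⟨f, hf⟩ := SignedDigraph.isAlternative_iff_exists_isSignLabelling.1 hD
  refine SignedDigraph.isAlternative_iff_exists_isSignLabelling.2
    ⟨fun R => Sum.elim f (fun _ => D.type c) (h.regionEquiv R), ?_⟩
  rintro (x | y)
  · exact hf x.1
  · exact ⟨elim_sideRegion_tangleDart_eq_type h hf hs (ht y) (even_val_add_two _),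
      elim_sideRegion_tangleDart_eq_type h hf hs (ht y) Iff.rfl⟩

end OrientedDiagram

end Twisting

theorem mainTheorem3 (D : Twisting.OrientedDiagram) (hD : D.IsSpherical) (hA : D.IsAlternative)
    (c : D.Crossing) (r : Fin 4) (B : Twisting.Block) (o : B.toTangle.Orientation)
    (hfit : o.Fits D c r) (hext : B.ExtendsOriented o D c r) :
    (D.replace c r o hfit).IsAlternative ∧ (D.replace c r o hfit).IsSpherical :=
  ⟨hA.replace hfit hext.sign.hasSlope hext.type, hD.replace hfit⟩
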